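/- Let $d\ge 1$, $\mathbb I^d:=[-1,1]^d$ and $\sigma(t)=\max\{t,0\}$ (applied coordinatewise to vectors). A deep fully connected (ReLU) net (DFCN) with $L\ge 1$ layers is a function $$x\mapsto a\cdot \sigma\circ\mathcal J_L\circ\sigma\circ\mathcal J_{L-1}\circ\dots\circ\sigma\circ\mathcal J_1(x),\qquad x\in\mathbb R^d,\quad \mathcal J_\ell(u)=W_\ell u+b_\ell,$$ with widths $d_0=d$, $d_1,\dots,d_L\ge 1$, arbitrary (full) matrices $W_\ell\in\mathbb R^{d_\ell\times d_{\ell-1}}$, $b_\ell\in\mathbb R^{d_\ell}$ and $a\in\mathbb R^{d_L}$. Its number of free parameters is $\sum_{\ell=1}^L(d_\ell d_{\ell-1}+d_\ell)+d_L$. For a measurable set $\mathcal X\subseteq\mathbb I^d$ and $p\in[2,\infty)$, let $\Xi_p$ be the set of Borel probability measures $\rho$ on $\mathcal X$ for which the identity mapping $L^p(\mathcal X)\to L^2_{\rho}$ ($L^p(\mathcal X)$ taken with respect to Lebesgue measure) is well defined and bounded. Write $\log^+\frac1\varepsilon:=\max\{\log\frac1\varepsilon,0\}$. There are constants $c_1,c_2>0$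 depending only on $d$ such that the following holds. Let $g_{n,L}$ be any DFCN with $L$ layers and $n$ free parameters satisfying $\|g_{n,L}\|_{L^\infty(\mathbb I^d)}\le C^*$ for some $C^*>0$, let $\rho_X\in\Xi_p$ for some $p\in[2,\infty)$, and let $D=\{(x_i,y_i)\}_{i=1}^m$ with pairwise distinct $x_i\in\mathbb I^d$ and $y_i\in\mathbb R$. Then for every $\varepsilon>0$ there exists a DFCN $f_{D,g}$ with $L+\lceil c_1\log^+\frac1\varepsilon\rceil$ layers and at most $c_2\left(m+n+\log^+\frac1\varepsilon\right)$ free parameters such that $$f_{D,g}(x_i)=y_i,\qquad i=1,\dots,m,$$ and $$\|f_{D,g}-g_{n,L}\|_{L^2_{\rho_X}}\le\varepsilon .$$ -/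

import Mathlib

open MeasureTheory
open scoped ENNReal

/-- The cube `[-1,1]^d`. -/
def cube (d : ℕ) : Set (Fin d → ℝ) := Set.Icc (fun _ => -1) (fun _ => 1)

/-- The ReLU function `t ↦ max {t, 0}`. -/
noncomputable def relu (t : ℝ) : ℝ := max t 0

/-- `HiddenLayers d L k`: the data of `L` successive fully connected hidden layers with input
dimension `d` and last width `k`. Each layer has a positive width `k'`, an arbitrary (full) weight
matrix `W` and an arbitrary bias vector `b`. -/
inductive HiddenLayers (d : ℕ) : ℕ → ℕ → Type
  | input : HiddenLayers d 0 d
  | layer {L k : ℕ} (N : HiddenLayers d L k) (k' : ℕ) (hk' : 0 < k')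
      (W : Matrix (Fin k') (Fin k) ℝ) (b : Fin k' → ℝ) : HiddenLayers d (L + 1) k'

/-- The map `σ ∘ J_L ∘ ⋯ ∘ σ ∘ J_1`, where `J_ℓ x = W_ℓ x + b_ℓ` and `σ` is applied
coordinatewise. -/
noncomputable def HiddenLayers.eval {d : ℕ} :
    {L k : ℕ} → HiddenLayers d L k → (Fin d → ℝ) → (Fin k → ℝ)
  | _, _, .input, x => x
  | _, _, .layer N _ _ W b, x => fun i => relu ((W.mulVec (N.eval x) + b) i)

/-- The number of entries of all the weight matrices and bias vectors. -/
def HiddenLayers.numParams {d : ℕ} : {L k : ℕ} → HiddenLayers d L k → ℕ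
  | _, _, .input => 0
  | _, _, .layer (k := k) N k' _ _ _ => N.numParams + (k' * k + k')

/-- A deep fully connected ReLU net on `ℝ^d` with `L` (hidden) layers and outer weights `a`. -/
structure DFCN (d L : ℕ) where
  width : ℕ
  layers : HiddenLayers d L width
  a : Fin width → ℝ

/-- The function `x ↦ a · σ ∘ J_L ∘ ⋯ ∘ σ ∘ J_1 (x)` realized by the net. -/
noncomputable def DFCN.eval {d L : ℕ} (N : DFCN d L) (x : Fin d → ℝ) : ℝ :=
  ∑ i, N.a i * N.layers.eval x i

/-- The number of free parameters: all entries of the weight matrices, of the bias vectors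
and of the outer weight vector, whether or not they vanish. -/
def DFCN.numParams {d L : ℕ} (N : DFCN d L) : ℕ := N.layers.numParams + N.width

/-- The distortion of `ρ` with respect to Lebesgue measure on `X`: the norm, in `[0, ∞]`, of the
identity mapping `L^p(X) → L²_ρ`. It is infinite if this mapping is unbounded, or not well defined
on classes of functions that agree Lebesgue-almost everywhere on `X`. -/
noncomputable def distortion {d : ℕ} (X : Set (Fin d → ℝ)) (ρ : Measure (Fin d → ℝ))
    (p : ℝ≥0∞) : ℝ≥0∞ :=
  sInf {C : ℝ≥0∞ | ∀ u : (Fin d → ℝ) → ℝ, Measurable u →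
    eLpNorm u p (volume.restrict X) < ∞ →
      eLpNorm u 2 ρ ≤ C * eLpNorm u p (volume.restrict X)}

open Filter Topology

/-! Add to `g` a net `h` that interpolates the residuals `y i - g (x i)` and has tiny `L²_ρ` norm.
Finite distortion forces `ρ ≪ volume`, so hyperplanes are `ρ`-null. A linear functional `w`
separates the data; `h` is a sum of bumps around zero sets of piecewise linear functions of `w`,
hence around finitely many hyperplanes. Steepening the bumps shrinks their support to a null set
while their height stays bounded, so any accuracy is reached at fixed size (`exists_bump_sum`). The
logarithmic number of extra layers is mere padding (`DFCN.exists_add_layers`).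

The difficulty is the parameter count: with full matrices, `4 * m` bump neurons beside a wide layer
of `g` would cost a product. Instead, `A` shared breakpoints in layer one and `4 * B` bump neurons
in layer two memorize `A * B` points (`exists_brokenLines`). Taking `B` to be the second width of
`g` and `A` about `m / B` keeps the cost linear in `m + n`; deeper layers carry `h` by two neurons
(`exists_augmented_layers`). -/

lemma relu_of_nonneg {t : ℝ} (h : 0 ≤ t) : relu t = t := max_eq_left h

lemma relu_of_nonpos {t : ℝ} (h : t ≤ 0) : relu t = 0 := max_eq_right h

lemma relu_sub_relu_neg (t : ℝ) : relu t - relu (-t) = t := by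
  rcases le_total 0 t with h | h
  · rw [relu_of_nonneg h, relu_of_nonpos (by linarith)]; ring
  · rw [relu_of_nonpos h, relu_of_nonneg (by linarith)]; ring

lemma continuous_relu : Continuous relu := continuous_id.max continuous_const

lemma abs_relu_sub_relu_le (s t : ℝ) : |relu s - relu t| ≤ |s - t| :=
  abs_max_sub_max_le_abs s t 0

/-! ### Four-neuron bumps with prescribed height -/

/-- A signed bump in the variable `u`, with value `v` at `u = 0`, vanishing for `2 * M ≤ |u|`
as soon as `|v| ≤ M`. -/
noncomputable def bump (M u v : ℝ) : ℝ :=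
  relu (u + v + M) + relu (u - v - M) - relu (u + M) - relu (u - M)

lemma bump_zero {M v : ℝ} (hv : |v| ≤ M) : bump M 0 v = v := by
  have := abs_le.1 hv
  unfold bump
  rw [relu_of_nonneg (by linarith), relu_of_nonpos (by linarith), relu_of_nonneg (by linarith),
    relu_of_nonpos (by linarith)]
  ring

/-- For such `u` the four arguments lie on the same side of `0`, so the sum is linear there and
cancels. -/
lemma bump_eq_zero {M u v : ℝ} (hv : |v| ≤ M) (hu : 2 * M ≤ |u|) : bump M u v = 0 := by
  have := abs_le.1 hv
  unfold bump
  rcases le_abs.1 hu with h | h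
  · rw [relu_of_nonneg (by linarith), relu_of_nonneg (by linarith), relu_of_nonneg (by linarith),
      relu_of_nonneg (by linarith)]
    ring
  · rw [relu_of_nonpos (by linarith), relu_of_nonpos (by linarith), relu_of_nonpos (by linarith),
      relu_of_nonpos (by linarith)]
    ring

lemma abs_bump_le (M u v : ℝ) : |bump M u v| ≤ 2 * |v| := by
  have h1 := abs_relu_sub_relu_le (u + v + M) (u + M)
  have h2 := abs_relu_sub_relu_le (u - v - M) (u - M)
  rw [show u + v + M - (u + M) = v by ring] at h1
  rw [show u - v - M - (u - M) = -v by ring, abs_neg] at h2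
  calc |bump M u v|
      = |(relu (u + v + M) - relu (u + M)) + (relu (u - v - M) - relu (u - M))| := by
        unfold bump; congr 1; ring
    _ ≤ _ := abs_add_le _ _
    _ ≤ 2 * |v| := by linarith

/-! ### Piecewise linear functions with shared breakpoints -/

/-- The continuous piecewise linear function, constant equal to `β` on `(-∞, e 0]`, whose first `A`
breakpoints are `e 0, e 1, …` and which takes the value `q k` at `s k`. -/
noncomputable def brokenLine (e s q : ℕ → ℝ) (β : ℝ) : ℕ → ℝ → ℝ
  | 0, _ => β
  | A + 1, t => brokenLine e s q β A t
      + (q A - brokenLine e s q β A (s A)) / (s A - e A) * relu (t - e A)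

section brokenLine

variable {e s q : ℕ → ℝ} {β : ℝ}

lemma brokenLine_eq_sum (A : ℕ) : ∃ c : ℕ → ℝ, ∀ t,
    brokenLine e s q β A t = ∑ l : Fin A, c l * relu (t - e l) + β := by
  refine ⟨fun l => (q l - brokenLine e s q β l (s l)) / (s l - e l), fun t => ?_⟩
  induction A with
  | zero => simp [brokenLine]
  | succ A ih => rw [brokenLine, ih, Fin.sum_univ_castSucc]; simp only [Fin.val_castSucc,
      Fin.val_last]; ring

lemma brokenLine_add_of_le (he : StrictMono e) {A : ℕ} {t : ℝ} (ht : t ≤ e A) (j : ℕ) :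
    brokenLine e s q β (A + j) t = brokenLine e s q β A t := by
  induction j with
  | zero => rfl
  | succ j ih =>
    have : e A ≤ e (A + j) := he.monotone (Nat.le_add_right _ _)
    rw [← add_assoc, brokenLine, ih, relu_of_nonpos (by linarith)]
    ring

lemma brokenLine_apply (he : StrictMono e) (hs : ∀ k, e k < s k) (hs' : ∀ k, s k < e (k + 1))
    {A k : ℕ} (hk : k < A) : brokenLine e s q β A (s k) = q k := by
  obtain ⟨j, rfl⟩ := Nat.exists_eq_add_of_le (Nat.succ_le_of_lt hk)
  rw [brokenLine_add_of_le he (hs' k).le, brokenLine, relu_of_nonneg (by linarith [hs k]),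
    div_mul_cancel₀ _ (by linarith [hs k])]
  ring

lemma brokenLine_succ_affine (he : StrictMono e) (A : ℕ) :
    ∃ a b : ℝ, ∀ t, e A ≤ t → brokenLine e s q β (A + 1) t = a + b * t := by
  have key : ∃ a b : ℝ, ∀ t, e A ≤ t → brokenLine e s q β A t = a + b * t := by
    induction A with
    | zero => exact ⟨β, 0, fun t _ => by simp [brokenLine]⟩
    | succ A ih =>
      obtain ⟨a, b, h⟩ := ih
      set c := (q A - brokenLine e s q β A (s A)) / (s A - e A) with hc
      refine ⟨a - c * e A, b + c, fun t ht => ?_⟩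
      have := he (Nat.lt_succ_self A)
      rw [brokenLine, h t (by linarith), relu_of_nonneg (by linarith), ← hc]
      ring
  obtain ⟨a, b, h⟩ := key
  set c := (q A - brokenLine e s q β A (s A)) / (s A - e A) with hc
  refine ⟨a - c * e A, b + c, fun t ht => ?_⟩
  rw [brokenLine, h t ht, relu_of_nonneg (by linarith), ← hc]
  ring

/-- Between consecutive breakpoints, and after the last, the function is affine, vanishes at the
interior point `s k` and is nonzero at `e k`; so `s k` is the only zero there. The initial value `1`
excludes zeros before `e 0`. -/
lemma brokenLine_eq_zero_iff (he : StrictMono e) (hs : ∀ k, e k < s k)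
    (hs' : ∀ k, s k < e (k + 1)) (A : ℕ) (t : ℝ) :
    brokenLine e s 0 1 A t = 0 ↔ ∃ k < A, t = s k := by
  induction A generalizing t with
  | zero => simp [brokenLine]
  | succ A ih =>
    have hlt : ∀ k < A, s k < e A := fun k hk =>
      (hs' k).trans_le (he.monotone (Nat.succ_le_of_lt hk))
    rcases le_or_gt t (e A) with ht | ht
    · rw [brokenLine_add_of_le he ht 1, ih]
      constructor
      · rintro ⟨k, hk, rfl⟩
        exact ⟨k, hk.trans (Nat.lt_succ_self _), rfl⟩
      · rintro ⟨k, hk, rfl⟩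
        refine ⟨k, lt_of_le_of_ne (Nat.le_of_lt_succ hk) ?_, rfl⟩
        rintro rfl
        linarith [hs k]
    · constructor
      · intro h0
        refine ⟨A, Nat.lt_succ_self A, ?_⟩
        obtain ⟨a, b, hab⟩ := brokenLine_succ_affine (s := s) (q := 0) (β := 1) he A
        have h1 : a + b * s A = 0 := by
          rw [← hab _ (hs A).le, brokenLine_apply he hs hs' (Nat.lt_succ_self A)]; rfl
        have h2 : a + b * e A ≠ 0 := by
          rw [← hab _ le_rfl, brokenLine_add_of_le he le_rfl 1, Ne, ih]
          rintro ⟨k, hk, hk'⟩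
          linarith [hlt k hk]
        rw [hab t ht.le] at h0
        have hb : b ≠ 0 := by
          rintro rfl
          apply h2
          linarith
        exact mul_left_cancel₀ hb (by linarith)
      · rintro ⟨k, hk, rfl⟩
        exact brokenLine_apply he hs hs' hk

end brokenLine

/-- The sentinel at index `0` leaves room for a breakpoint before the first point; continuing past
`S` makes the last block of points complete. -/
lemma exists_strictMono_enumeration (b : ℝ) (S : Finset ℝ) (hb : ∀ s ∈ S, b < s) :
    ∃ T : ℕ → ℝ, StrictMono T ∧ T 0 = b ∧ (∀ i < S.card, T (i + 1) ∈ S) ∧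
      ∀ s ∈ S, ∃ i < S.card, T (i + 1) = s := by
  classical
  induction S using Finset.induction_on_max with
  | empty => exact ⟨fun i => b + i, fun i j h => by simpa using h, by simp, by simp, by simp⟩
  | insert a S ha ih =>
    obtain ⟨T, hT, h0, hmem, hsurj⟩ := ih fun s hs => hb s (Finset.mem_insert_of_mem hs)
    have haS : a ∉ S := fun h => lt_irrefl _ (ha a h)
    have hlast : T S.card < a := by
      rcases Nat.eq_zero_or_pos S.card with h | h
      · rw [h, h0]; exact hb a (Finset.mem_insert_self _ _)
      · have := hmem (S.card - 1) (by omega)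
        rw [Nat.sub_add_cancel h] at this
        exact ha _ this
    refine ⟨fun i => if i ≤ S.card then T i else a + (i - S.card - 1), ?_, ?_, ?_, ?_⟩
    · refine strictMono_nat_of_lt_succ fun i => ?_
      rcases lt_trichotomy i S.card with h | h | h
      · rw [if_pos h.le, if_pos (Nat.succ_le_of_lt h)]
        exact hT (Nat.lt_succ_self i)
      · subst h
        simpa using hlast
      · rw [if_neg (by omega), if_neg (by omega)]
        push_cast
        linarith
    · simpa using h0
    · intro i hi
      rw [Finset.card_insert_of_notMem haS] at hi
      rcases Nat.lt_succ_iff_lt_or_eq.1 hi with h | h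
      · simp only [Nat.succ_le_of_lt h, if_true]
        exact Finset.mem_insert_of_mem (hmem i h)
      · subst h
        simp
    · intro s hs
      rw [Finset.card_insert_of_notMem haS]
      rcases Finset.mem_insert.1 hs with rfl | hs
      · exact ⟨S.card, Nat.lt_succ_self _, by simp⟩
      · obtain ⟨i, hi, h⟩ := hsurj s hs
        exact ⟨i, hi.trans (Nat.lt_succ_self _), by simpa [Nat.succ_le_of_lt hi] using h⟩

/-- Piecewise linear functions `U j`, `V j` with `A` common breakpoints, such that every point `t`
of a given set of at most `A * B` points is a zero of exactly one `U j`, where `V j` has a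
prescribed value. -/
lemma exists_brokenLines (S : Finset ℝ) (r : ℝ → ℝ) (A B : ℕ) (hB : 0 < B)
    (hAB : S.card ≤ A * B) :
    ∃ (e : Fin A → ℝ) (U V : Fin B → ℝ → ℝ),
      (∀ j, ∃ (c : Fin A → ℝ) (β : ℝ), ∀ t, U j t = ∑ l, c l * relu (t - e l) + β) ∧
      (∀ j, ∃ (c : Fin A → ℝ) (β : ℝ), ∀ t, V j t = ∑ l, c l * relu (t - e l) + β) ∧
      (∀ j, {t | U j t = 0}.Finite) ∧
      ∀ t ∈ S, ∃ j, U j t = 0 ∧ V j t = r t ∧ ∀ j', j' ≠ j → U j' t ≠ 0 := by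
  obtain ⟨b, hb⟩ := S.finite_toSet.bddBelow
  obtain ⟨T, hT, -, -, hS⟩ := exists_strictMono_enumeration (b - 1) S
    fun s hs => by linarith [hb (Finset.mem_coe.2 hs)]
  -- The points `T 1, T 2, …` are cut into blocks of length `B`; `e k` separates block `k` from what
  -- precedes it, and `s j k` below is the `j`-th point of block `k`.
  set e : ℕ → ℝ := fun k => (T (k * B) + T (k * B + 1)) / 2 with he_def
  have hlo : ∀ k, e k < T (k * B + 1) := fun k => by
    have := hT (Nat.lt_succ_self (k * B)); simp only [he_def, Nat.succ_eq_add_one] at *; linarith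
  have hhi : ∀ k, T (k * B) < e k := fun k => by
    have := hT (Nat.lt_succ_self (k * B)); simp only [he_def, Nat.succ_eq_add_one] at *; linarith
  let s : ℕ → ℕ → ℝ := fun j k => T (k * B + 1 + j)
  have hs : ∀ j k, e k < s j k := fun j k =>
    (hlo k).trans_le (hT.monotone (Nat.le_add_right _ _))
  have hs' : ∀ j < B, ∀ k, s j k < e (k + 1) := fun j hj k =>
    lt_of_le_of_lt (hT.monotone (by rw [add_mul]; omega)) (hhi (k + 1))
  have he : StrictMono e := strictMono_nat_of_lt_succ fun k => (hs 0 k).trans (hs' 0 hB k)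
  refine ⟨fun l => e l, fun j => brokenLine e (s j) 0 1 A,
    fun j => brokenLine e (s j) (fun k => r (s j k)) 0 A, fun j => ?_, fun j => ?_, fun j => ?_,
    fun t ht => ?_⟩
  · obtain ⟨c, hc⟩ := brokenLine_eq_sum (e := e) (s := s j) (q := 0) (β := 1) A
    exact ⟨fun l => c l, 1, hc⟩
  · obtain ⟨c, hc⟩ := brokenLine_eq_sum (e := e) (s := s j) (q := fun k => r (s j k)) (β := 0) A
    exact ⟨fun l => c l, 0, hc⟩
  · refine ((Set.finite_Iio A).image (s j)).subset fun t ht => ?_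
    obtain ⟨k, hk, rfl⟩ := (brokenLine_eq_zero_iff he (hs j) (hs' j j.2) A t).1 ht
    exact ⟨k, hk, rfl⟩
  · obtain ⟨i, hi, rfl⟩ := hS t ht
    have hk : i / B < A := Nat.div_lt_of_lt_mul (by rw [mul_comm]; omega)
    have hj : i % B < B := Nat.mod_lt _ hB
    have hij : T (i + 1) = s (i % B) (i / B) := by
      show T (i + 1) = T _
      congr 1
      have := Nat.div_add_mod' i B
      omega
    refine ⟨⟨i % B, hj⟩, ?_, ?_, fun j' hj' h => hj' ?_⟩
    · rw [hij]; exact brokenLine_apply he (hs _) (hs' _ hj) hk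
    · rw [hij]; exact brokenLine_apply he (hs _) (hs' _ hj) hk
    · obtain ⟨k, -, hk'⟩ := (brokenLine_eq_zero_iff he (hs j') (hs' j' j'.2) A _).1 h
      have := hT.injective hk'
      have h2 : i = j' + k * B := by omega
      ext
      show (j' : ℕ) = i % B
      rw [h2, Nat.add_mul_mod_self_right, Nat.mod_eq_of_lt j'.2]

/-! ### Smallness in `L²` of narrow bumps -/

/-- Narrow bumps along the zero sets of the `U j`: they interpolate and are small in `L²`. -/
lemma exists_bump_sum {d : ℕ} {ι : Type*} [Fintype ι] (ρ : Measure (Fin d → ℝ))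
    [IsFiniteMeasure ρ] (hρ : ∀ᵐ z ∂ρ, z ∈ cube d) (U V : ι → (Fin d → ℝ) → ℝ)
    (hU : ∀ j, Continuous (U j)) (hV : ∀ j, Continuous (V j)) (hU0 : ∀ j, ρ {z | U j z = 0} = 0)
    {m : ℕ} (x : Fin m → Fin d → ℝ) (hx : ∀ i, x i ∈ cube d) (r : Fin m → ℝ)
    (h : ∀ i, ∃ j, U j (x i) = 0 ∧ V j (x i) = r i ∧ ∀ j', j' ≠ j → U j' (x i) ≠ 0)
    {ε : ℝ} (hε : 0 < ε) :
    ∃ M κ : ℝ, (∀ i, ∑ j, bump M (κ * U j (x i)) (V j (x i)) = r i) ∧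
      eLpNorm (fun z => ∑ j, bump M (κ * U j z) (V j z)) 2 ρ ≤ ENNReal.ofReal ε := by
  classical
  obtain ⟨M, hM0, hM⟩ : ∃ M : ℝ, 0 < M ∧ ∀ j, ∀ z ∈ cube d, |V j z| ≤ M := by
    have hc : IsCompact (cube d) := isCompact_Icc
    have : ∀ j, ∃ M : ℝ, ∀ z ∈ cube d, |V j z| ≤ M := fun j =>
      hc.exists_bound_of_continuousOn (hV j).continuousOn
    choose M hM using this
    refine ⟨1 + ∑ j, |M j|, by positivity, fun j z hz => (hM j z hz).trans ?_⟩
    have := Finset.single_le_sum (f := fun j => |M j|) (fun j _ => abs_nonneg _)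
      (Finset.mem_univ j)
    have := le_abs_self (M j)
    linarith
  -- On the cube, `s n` contains the support of the bump sum with steepness `n + 1`; these sets
  -- decrease into the union of the zero sets.
  let s : ℕ → Set (Fin d → ℝ) := fun n => {z | ∃ j, ((n : ℝ) + 1) * |U j z| < 2 * M}
  have hs : ∀ n, MeasurableSet (s n) := fun n => by
    simp only [s, Set.ofPred_exists]
    exact MeasurableSet.iUnion fun j =>
      (isOpen_lt (continuous_const.mul (hU j).abs) continuous_const).measurableSet
  have hanti : Antitone s := fun a b hab z ⟨j, hj⟩ => ⟨j, lt_of_le_of_lt (by gcongr) hj⟩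
  have hsU : ⋂ n, s n ⊆ ⋃ j, {z | U j z = 0} := fun z hz => by
    by_contra hne
    simp only [Set.mem_iUnion, Set.mem_ofPred_eq, not_exists] at hne
    have : ∀ᶠ n : ℕ in atTop, ∀ j, 2 * M ≤ ((n : ℝ) + 1) * |U j z| := by
      rw [eventually_all]
      intro j
      exact (((tendsto_natCast_atTop_atTop.atTop_add tendsto_const_nhds).atTop_mul_const
        (abs_pos.2 (hne j))).eventually_ge_atTop _)
    obtain ⟨n, hn⟩ := this.exists
    obtain ⟨j, hj⟩ := Set.mem_iInter.1 hz n
    exact absurd (hn j) (not_le.2 hj)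
  have hlim : Tendsto (ρ ∘ s) atTop (𝓝 0) := by
    have := tendsto_measure_iInter_atTop (μ := ρ) (fun n => (hs n).nullMeasurableSet) hanti
      ⟨0, measure_ne_top _ _⟩
    rwa [measure_mono_null hsU (measure_iUnion_null hU0)] at this
  -- A bound on the bump sum that does not depend on the steepness.
  set K : ℝ := Fintype.card ι * (2 * M) with hK
  have hlim2 : Tendsto (fun n => ‖K‖ₑ * (ρ (s n)) ^ (1 / (2 : ℝ))) atTop (𝓝 0) := by
    have h1 : Tendsto (fun n => (ρ (s n)) ^ (1 / (2 : ℝ))) atTop (𝓝 0) := by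
      have := hlim.ennrpow_const (1 / (2 : ℝ))
      rwa [ENNReal.zero_rpow_of_pos (by norm_num)] at this
    simpa using ENNReal.Tendsto.const_mul h1 (Or.inr (enorm_ne_top (x := K)))
  have hsmall : ∀ᶠ n in atTop, ‖K‖ₑ * (ρ (s n)) ^ (1 / (2 : ℝ)) ≤ ENNReal.ofReal ε :=
    (hlim2.eventually_lt_const (by simpa using hε)).mono fun n hn => hn.le
  have hinterp : ∀ᶠ n : ℕ in atTop, ∀ i j, U j (x i) ≠ 0 →
      2 * M ≤ ((n : ℝ) + 1) * |U j (x i)| := by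
    simp only [eventually_all]
    intro i j hij
    exact (((tendsto_natCast_atTop_atTop.atTop_add tendsto_const_nhds).atTop_mul_const
        (abs_pos.2 hij)).eventually_ge_atTop _)
  obtain ⟨n, hn1, hn2⟩ := (hsmall.and hinterp).exists
  have habs : ∀ u : ℝ, |((n : ℝ) + 1) * u| = ((n : ℝ) + 1) * |u| := fun u => by
    rw [abs_mul, abs_of_pos (by positivity)]
  refine ⟨M, (n : ℝ) + 1, fun i => ?_, ?_⟩
  · obtain ⟨j, h1, h2, h3⟩ := h i
    rw [Finset.sum_eq_single j, h1, mul_zero, bump_zero (hM j _ (hx i)), h2]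
    · intro j' _ hj'
      exact bump_eq_zero (hM _ _ (hx i)) (by rw [habs]; exact hn2 i j' (h3 j' hj'))
    · simp
  · calc eLpNorm (fun z => ∑ j, bump M (((n : ℝ) + 1) * U j z) (V j z)) 2 ρ
        ≤ eLpNorm ((s n).indicator fun _ => K) 2 ρ := by
          refine eLpNorm_mono_ae ?_
          filter_upwards [hρ] with z hz
          by_cases hzs : z ∈ s n
          · rw [Set.indicator_of_mem hzs, Real.norm_eq_abs, Real.norm_eq_abs,
              abs_of_nonneg (by positivity : 0 ≤ K)]
            refine (Finset.abs_sum_le_sum_abs _ _).trans ?_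
            refine (Finset.sum_le_card_nsmul _ _ (2 * M) fun j _ => ?_).trans ?_
            · exact (abs_bump_le _ _ _).trans (by linarith [hM j z hz])
            · simp [hK]
          · rw [Set.indicator_of_notMem hzs, Finset.sum_eq_zero]
            intro j _
            refine bump_eq_zero (hM j z hz) ?_
            rw [habs]
            by_contra hlt
            exact hzs ⟨j, not_le.1 hlt⟩
      _ = ‖K‖ₑ * (ρ (s n)) ^ (1 / (2 : ℝ)) := by
          rw [eLpNorm_indicator_const (hs n) (by norm_num) (by norm_num)]; norm_num
      _ ≤ _ := hn1

/-! ### Null hyperplanes and separating functionals -/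

/-- The indicator of a Lebesgue-null set has `L^p` norm zero, so the norm inequality makes its
`L²_ρ` norm zero too. -/
lemma absolutelyContinuous_of_distortion_lt_top {d : ℕ} {X : Set (Fin d → ℝ)}
    {ρ : Measure (Fin d → ℝ)} {p : ℝ≥0∞} (h : distortion X ρ p < ∞) : ρ ≪ volume := by
  refine Measure.AbsolutelyContinuous.mk fun N hN hN0 => ?_
  obtain ⟨C, hC, -⟩ := sInf_lt_iff.1 h
  have hz : eLpNorm (N.indicator fun _ => (1 : ℝ)) p (volume.restrict X) = 0 := by
    refine eLpNorm_eq_zero_of_ae_zero ?_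
    have : volume.restrict X N = 0 := Measure.restrict_le_self.absolutelyContinuous hN0
    exact indicator_meas_zero this
  have := hC (N.indicator fun _ => 1) (measurable_const.indicator hN) (by rw [hz]; simp)
  rw [hz, mul_zero, nonpos_iff_eq_zero, eLpNorm_indicator_const hN (by norm_num) (by norm_num)]
    at this
  simpa [not_lt_of_ge] using this

lemma measure_hyperplane_eq_zero {d : ℕ} {ρ : Measure (Fin d → ℝ)} (hρ : ρ ≪ volume)
    {w : Module.Dual ℝ (Fin d → ℝ)} (hw : w ≠ 0) (t : ℝ) : ρ {z | w z = t} = 0 := by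
  obtain ⟨v, hv⟩ := DFunLike.ne_iff.1 hw
  refine hρ ?_
  let P : AffineSubspace ℝ (Fin d → ℝ) :=
    (AffineSubspace.mk' t ⊥ : AffineSubspace ℝ ℝ).comap w.toAffineMap
  have hP : {z | w z = t} = (P : Set (Fin d → ℝ)) := by
    ext z; simp [P, AffineSubspace.mem_mk', sub_eq_zero]
  rw [hP]
  refine Measure.addHaar_affineSubspace _ _ fun htop => ?_
  have h : ∀ z, w z = t := fun z => by
    have : z ∈ (P : Set (Fin d → ℝ)) := by rw [htop]; trivial
    rwa [← hP] at this
  exact hv ((h v).trans ((h 0).symm.trans (map_zero w)))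

lemma exists_dual_injective_comp {d m : ℕ} (hd : 0 < d) {x : Fin m → Fin d → ℝ}
    (hx : Function.Injective x) :
    ∃ w : Module.Dual ℝ (Fin d → ℝ), w ≠ 0 ∧ Function.Injective fun i => w (x i) := by
  -- Besides the differences of data points, the vector `1` is included to force `w ≠ 0` even when
  -- `m ≤ 1`.
  let v : Option {q : Fin m × Fin m // q.1 ≠ q.2} → Fin d → ℝ :=
    fun o => o.elim 1 fun q => x q.1.1 - x q.1.2
  have : Nonempty (Fin d) := ⟨⟨0, hd⟩⟩
  obtain ⟨w, hw⟩ := Module.exists_dual_forall_apply_ne_zero (K := ℝ) v (by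
    rintro (_ | q)
    · exact one_ne_zero
    · exact sub_ne_zero.2 fun h => q.2 (hx h))
  refine ⟨w, ?_, fun i j hij => ?_⟩
  · rintro rfl
    exact hw none rfl
  · by_contra hne
    exact hw (some ⟨(i, j), hne⟩) (by simpa [v, sub_eq_zero] using hij)

/-! ### Building nets by membership in spans -/

variable {d : ℕ}

/-- `L` hidden layers with `P` parameters whose last layer computes the functions `F i`. -/
def Realizable {κ : Type} (L P : ℕ) (F : κ → (Fin d → ℝ) → ℝ) : Prop :=
  ∃ (k : ℕ) (N : HiddenLayers d L k) (e : κ ≃ Fin k),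
    N.numParams = P ∧ ∀ i z, N.eval z (e i) = F i z

/-- The linear combinations of the functions `F i`. -/
def linearReadouts {κ : Type} (F : κ → (Fin d → ℝ) → ℝ) : Submodule ℝ ((Fin d → ℝ) → ℝ) :=
  Submodule.span ℝ (Set.range F)

/-- The linear combinations of the functions `F i` and of the constant function `1`. -/
def affineReadouts {κ : Type} (F : κ → (Fin d → ℝ) → ℝ) : Submodule ℝ ((Fin d → ℝ) → ℝ) :=
  Submodule.span ℝ (insert 1 (Set.range F))

section readouts

variable {κ : Type} {F : κ → (Fin d → ℝ) → ℝ}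

lemma apply_mem_linearReadouts (i : κ) : F i ∈ linearReadouts F :=
  Submodule.subset_span ⟨i, rfl⟩

lemma linearReadouts_le_affineReadouts : linearReadouts F ≤ affineReadouts F :=
  Submodule.span_mono (Set.subset_insert _ _)

lemma const_mem_affineReadouts (c : ℝ) : (fun _ => c) ∈ affineReadouts F := by
  have : (fun _ => c) = c • (1 : (Fin d → ℝ) → ℝ) := by ext; simp
  rw [this]
  exact Submodule.smul_mem _ _ (Submodule.subset_span (Set.mem_insert _ _))

lemma linearReadouts_mono {κ' : Type} {F' : κ' → (Fin d → ℝ) → ℝ}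
    (h : ∀ i, F i ∈ linearReadouts F') : linearReadouts F ≤ linearReadouts F' :=
  Submodule.span_le.2 (Set.range_subset_iff.2 h)

lemma affineReadouts_mono {κ' : Type} {F' : κ' → (Fin d → ℝ) → ℝ}
    (h : ∀ i, F i ∈ affineReadouts F') : affineReadouts F ≤ affineReadouts F' :=
  Submodule.span_le.2 (Set.insert_subset (const_mem_affineReadouts 1)
    (Set.range_subset_iff.2 h))

lemma mem_linearReadouts_iff [Fintype κ] {f : (Fin d → ℝ) → ℝ} :
    f ∈ linearReadouts F ↔ ∃ c : κ → ℝ, ∀ z, f z = ∑ i, c i * F i z := by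
  rw [linearReadouts, Submodule.mem_span_range_iff_exists_fun]
  refine exists_congr fun c => ⟨?_, fun h => ?_⟩
  · rintro rfl z; simp
  · ext z; simp [h]

lemma mem_affineReadouts_iff [Fintype κ] {f : (Fin d → ℝ) → ℝ} :
    f ∈ affineReadouts F ↔ ∃ (c : κ → ℝ) (b : ℝ), ∀ z, f z = ∑ i, c i * F i z + b := by
  rw [affineReadouts, Submodule.mem_span_insert]
  constructor
  · rintro ⟨b, g, hg, rfl⟩
    obtain ⟨c, hc⟩ := mem_linearReadouts_iff.1 hg
    exact ⟨c, b, fun z => by simp [hc, add_comm]⟩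
  · rintro ⟨c, b, h⟩
    exact ⟨b, fun z => ∑ i, c i * F i z, mem_linearReadouts_iff.2 ⟨c, fun _ => rfl⟩, by
      ext z; simp [h, add_comm]⟩

lemma linear_mem_affineReadouts (w : Module.Dual ℝ (Fin d → ℝ)) :
    (fun z => w z) ∈ affineReadouts (fun (i : Fin d) (z : Fin d → ℝ) => z i) :=
  mem_affineReadouts_iff.2 ⟨fun i => w (Pi.single i 1), 0, fun z => by
    rw [LinearMap.pi_apply_eq_sum_univ w z, add_zero]
    refine Finset.sum_congr rfl fun i _ => ?_
    rw [smul_eq_mul, mul_comm]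
    congr 2
    ext j
    simp [Pi.single_apply, eq_comm]⟩

/-- The four neurons forming a bump. -/
noncomputable def bumpNeurons {ι : Type} (M κ : ℝ) (U V : ι → (Fin d → ℝ) → ℝ) :
    ι × Fin 4 → (Fin d → ℝ) → ℝ := fun q =>
  ![fun z => κ * U q.1 z + V q.1 z + M, fun z => κ * U q.1 z - V q.1 z - M,
    fun z => κ * U q.1 z + M, fun z => κ * U q.1 z - M] q.2

lemma bumpNeurons_mem {ι : Type} {M c : ℝ} {U V : ι → (Fin d → ℝ) → ℝ}
    (hU : ∀ j, U j ∈ affineReadouts F) (hV : ∀ j, V j ∈ affineReadouts F) (q : ι × Fin 4) :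
    bumpNeurons M c U V q ∈ affineReadouts F := by
  obtain ⟨j, s⟩ := q
  have h1 : c • U j ∈ affineReadouts F := Submodule.smul_mem _ _ (hU j)
  have h2 := const_mem_affineReadouts (F := F) M
  fin_cases s
  · exact add_mem (add_mem h1 (hV j)) h2
  · exact sub_mem (sub_mem h1 (hV j)) h2
  · exact add_mem h1 h2
  · exact sub_mem h1 h2

lemma sum_bump_mem {ι : Type} [Fintype ι] (M c : ℝ) (U V : ι → (Fin d → ℝ) → ℝ) :
    (fun z => ∑ j, bump M (c * U j z) (V j z)) ∈
      linearReadouts fun q z => relu (bumpNeurons M c U V q z) := by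
  refine mem_linearReadouts_iff.2 ⟨fun q => ![1, 1, -1, -1] q.2, fun z => ?_⟩
  rw [Fintype.sum_prod_type]
  refine Finset.sum_congr rfl fun j _ => ?_
  simp [Fin.sum_univ_four, bumpNeurons, bump]
  ring

end readouts

lemma realizable_input : Realizable 0 0 (fun (i : Fin d) (z : Fin d → ℝ) => z i) :=
  ⟨d, .input, Equiv.refl _, rfl, fun _ _ => rfl⟩

/-- Affine readouts of one layer are exactly the possible preactivations of the next. Arbitrary
finite index types let nets be juxtaposed by sum types. -/
lemma Realizable.layer {κ κ' : Type} [Fintype κ] [Fintype κ'] [Nonempty κ'] {L P : ℕ}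
    {F : κ → (Fin d → ℝ) → ℝ} (h : Realizable L P F) {f : κ' → (Fin d → ℝ) → ℝ}
    (hf : ∀ i, f i ∈ affineReadouts F) :
    Realizable (L + 1) (P + (Fintype.card κ' * Fintype.card κ + Fintype.card κ'))
      fun i z => relu (f i z) := by
  obtain ⟨k, N, e, rfl, he⟩ := h
  obtain rfl : Fintype.card κ = k := by simpa using Fintype.card_congr e
  choose c b hcb using fun i => mem_affineReadouts_iff.1 (hf i)
  let e' := Fintype.equivFin κ'
  refine ⟨_, .layer N (Fintype.card κ') Fintype.card_pos
    (Matrix.of fun i j => c (e'.symm i) (e.symm j)) fun i => b (e'.symm i), e', rfl,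
    fun i z => ?_⟩
  simp only [HiddenLayers.eval, Pi.add_apply, Matrix.mulVec, dotProduct, Matrix.of_apply,
    Equiv.symm_apply_apply, hcb]
  congr 2
  rw [← e.sum_comp]
  simp [he]

lemma Realizable.exists_net {κ : Type} [Fintype κ] {L P : ℕ} {F : κ → (Fin d → ℝ) → ℝ}
    (h : Realizable L P F) {f : (Fin d → ℝ) → ℝ} (hf : f ∈ linearReadouts F) :
    ∃ N : DFCN d L, N.numParams = P + Fintype.card κ ∧ N.width = Fintype.card κ ∧
      ∀ z, N.eval z = f z := by
  obtain ⟨k, N, e, rfl, he⟩ := h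
  obtain rfl : Fintype.card κ = k := by simpa using Fintype.card_congr e
  obtain ⟨c, hc⟩ := mem_linearReadouts_iff.1 hf
  refine ⟨⟨_, N, fun j => c (e.symm j)⟩, rfl, rfl, fun z => ?_⟩
  simp only [DFCN.eval, hc]
  rw [← e.sum_comp]
  simp [he]

lemma HiddenLayers.realizable {L k : ℕ} (N : HiddenLayers d L k) :
    Realizable L N.numParams fun i z => N.eval z i :=
  ⟨k, N, Equiv.refl _, rfl, fun _ _ => rfl⟩

lemma DFCN.eval_mem_linearReadouts {L : ℕ} (N : DFCN d L) :
    N.eval ∈ linearReadouts fun i z => N.layers.eval z i :=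
  mem_linearReadouts_iff.2 ⟨N.a, fun _ => rfl⟩

/-- A layer of a given net, before the activation. -/
lemma layer_mem_affineReadouts {L k k' : ℕ} (N : HiddenLayers d L k)
    (W : Matrix (Fin k') (Fin k) ℝ) (b : Fin k' → ℝ) (i : Fin k') :
    (fun z => (W.mulVec (N.eval z) + b) i) ∈ affineReadouts fun j z => N.eval z j :=
  mem_affineReadouts_iff.2 ⟨W i, b i, fun _ => rfl⟩

lemma mem_of_eq_relu_sub {κ : Type} {F : κ → (Fin d → ℝ) → ℝ} {f : (Fin d → ℝ) → ℝ}
    (h1 : (fun z => relu (f z)) ∈ linearReadouts F)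
    (h2 : (fun z => relu (-f z)) ∈ linearReadouts F) : f ∈ linearReadouts F := by
  convert sub_mem h1 h2 using 1
  ext z
  exact (relu_sub_relu_neg _).symm

/-- Each new layer holds the positive and negative parts of the output. The first one pays for the
old width, hence `numParams + width` is tracked: it grows by exactly `6` per layer. -/
lemma DFCN.exists_add_layers {L : ℕ} (N : DFCN d L) (K : ℕ) :
    ∃ N' : DFCN d (L + K), N'.numParams + N'.width ≤ N.numParams + N.width + 6 * K ∧
      ∀ z, N'.eval z = N.eval z := by
  induction K with
  | zero => exact ⟨N, le_rfl, fun _ => rfl⟩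
  | succ K ih =>
    obtain ⟨N', hle, heq⟩ := ih
    have hN' := N'.eval_mem_linearReadouts
    let f : Fin 2 → (Fin d → ℝ) → ℝ := ![N'.eval, -N'.eval]
    have hf : ∀ i, f i ∈ affineReadouts fun i z => N'.layers.eval z i := by
      intro i
      have := linearReadouts_le_affineReadouts hN'
      fin_cases i
      · exact this
      · exact neg_mem this
    have hmem : N'.eval ∈ linearReadouts fun i z => relu (f i z) :=
      mem_of_eq_relu_sub (apply_mem_linearReadouts (F := fun i z => relu (f i z)) 0)
        (apply_mem_linearReadouts (F := fun i z => relu (f i z)) 1)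
    obtain ⟨N'', hp, hw, hev⟩ := (N'.layers.realizable.layer hf).exists_net hmem
    refine ⟨N'', ?_, fun z => (hev z).trans (heq z)⟩
    have : N'.numParams = N'.layers.numParams + N'.width := rfl
    simp only [Fintype.card_fin] at hp hw
    omega

/-! ### Inserting the memorizer into a given net -/

/-- If a function with the property `Good` is computed by two layers of any widths `A` and `4 * B`
with `m ≤ A * B`, then it can be added to the last layer of any net with at least two layers, at the
cost of a constant factor. -/
lemma exists_augmented_layers {Good : ((Fin d → ℝ) → ℝ) → Prop} {m : ℕ}
    (H : ∀ A B : ℕ, 0 < B → m ≤ A * B →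
      ∃ (φ : Fin A → (Fin d → ℝ) → ℝ) (ψ : Fin B × Fin 4 → (Fin d → ℝ) → ℝ) (h : (Fin d → ℝ) → ℝ),
        (∀ l, φ l ∈ affineReadouts fun (i : Fin d) (z : Fin d → ℝ) => z i) ∧
        (∀ q, ψ q ∈ affineReadouts fun l z => relu (φ l z)) ∧
        h ∈ linearReadouts (fun q z => relu (ψ q z)) ∧ Good h)
    {L k : ℕ} (N : HiddenLayers d L k) (hL : 2 ≤ L) :
    ∃ (κ : Type) (_ : Fintype κ) (F : κ → (Fin d → ℝ) → ℝ) (P : ℕ) (h : (Fin d → ℝ) → ℝ),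
      Realizable L P F ∧ (∀ i, (fun z => N.eval z i) ∈ linearReadouts F) ∧
      h ∈ linearReadouts F ∧ Good h ∧ Fintype.card κ ≤ 5 * k ∧
      P ≤ (d + 20) * (m + N.numParams) := by
  induction N with
  | input => omega
  | @layer L k N k' hk' W b ih =>
    have : Nonempty (Fin k') := ⟨⟨0, hk'⟩⟩
    rcases Nat.lt_or_ge L 2 with hL' | hL'
    · obtain rfl : L = 1 := by omega
      cases N with
      | @layer _ k₀ N₀ k₁ hk₁ W₁ b₁ =>
      cases N₀
      have : Nonempty (Fin k) := ⟨⟨0, hk₁⟩⟩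
      -- With `B = k'` and `A = m / k' + 1`, the product `A * B` lies between `m` and `m + k'`, so
      -- the new weights between the two layers number `O(m + k * k')`.
      have hA : m ≤ (m / k' + 1) * k' := by
        have := Nat.lt_div_mul_add (a := m) hk'
        rw [add_mul]; omega
      have hA1 : (m / k' + 1) * k' ≤ m + k' := by
        rw [add_mul]; have := Nat.div_mul_le_self m k'; omega
      have hA2 : m / k' + 1 ≤ m + 1 := Nat.succ_le_succ (Nat.div_le_self _ _)
      generalize m / k' + 1 = A at hA hA1 hA2
      obtain ⟨φ, ψ, h, hφ, hψ, hh, hgood⟩ := H A k' hk' hA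
      let f₁ : Fin k ⊕ Fin A → (Fin d → ℝ) → ℝ :=
        Sum.elim (fun i z => (W₁.mulVec z + b₁) i) φ
      have hf₁ : ∀ i, f₁ i ∈ affineReadouts fun (i : Fin d) (z : Fin d → ℝ) => z i := by
        rintro (i | l)
        · exact layer_mem_affineReadouts .input W₁ b₁ i
        · exact hφ l
      have R₁ := realizable_input.layer hf₁
      let f₂ : Fin k' ⊕ Fin k' × Fin 4 → (Fin d → ℝ) → ℝ :=
        Sum.elim (fun i z => (W.mulVec ((HiddenLayers.layer .input k hk₁ W₁ b₁).eval z) + b) i) ψ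
      have hf₂ : ∀ i, f₂ i ∈ affineReadouts fun i z => relu (f₁ i z) := by
        rintro (i | q)
        · refine affineReadouts_mono (fun j => linearReadouts_le_affineReadouts ?_)
            (layer_mem_affineReadouts (.layer .input k hk₁ W₁ b₁) W b i)
          exact apply_mem_linearReadouts (F := fun i z => relu (f₁ i z)) (Sum.inl j)
        · refine affineReadouts_mono (fun j => linearReadouts_le_affineReadouts ?_) (hψ q)
          exact apply_mem_linearReadouts (F := fun i z => relu (f₁ i z)) (Sum.inr j)
      have R₂ := R₁.layer hf₂
      refine ⟨_, inferInstance, _, _, h, R₂, fun i => ?_, ?_, hgood, ?_, ?_⟩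
      · exact apply_mem_linearReadouts (F := fun i z => relu (f₂ i z)) (Sum.inl i)
      · refine linearReadouts_mono (fun q => ?_) hh
        exact apply_mem_linearReadouts (F := fun i z => relu (f₂ i z)) (Sum.inr q)
      · simp; omega
      · simp only [HiddenLayers.numParams, Fintype.card_sum, Fintype.card_prod, Fintype.card_fin]
        nlinarith [Nat.mul_le_mul_right d hA2, Nat.zero_le (d * (k * d)), Nat.zero_le (d * k),
          Nat.zero_le (d * (k' * k)), Nat.mul_le_mul_left d (show 1 ≤ k' from hk'),
          Nat.zero_le (d * m), hk₁]
    · obtain ⟨κ, _, F, P, h, hR, hN, hh, hgood, hcard, hP⟩ := ih hL'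
      -- Now `h` needs only the two neurons for `h` and `-h`. As `k' + 2 ≤ 3 * k'` and the previous
      -- width is at most `5 * k`, the new matrix has at most `15 * k' * k` entries.
      let f : Fin k' ⊕ Fin 2 → (Fin d → ℝ) → ℝ :=
        Sum.elim (fun i z => (W.mulVec (N.eval z) + b) i) ![h, -h]
      have hf : ∀ i, f i ∈ affineReadouts F := by
        have := linearReadouts_le_affineReadouts hh
        rintro (i | i)
        · exact affineReadouts_mono (fun j => linearReadouts_le_affineReadouts (hN j))
            (layer_mem_affineReadouts N W b i)
        · fin_cases i
          · exact this
          · exact neg_mem this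
      refine ⟨_, inferInstance, _, _, h, hR.layer hf, fun i => ?_, ?_, hgood, ?_, ?_⟩
      · exact apply_mem_linearReadouts (F := fun i z => relu (f i z)) (Sum.inl i)
      · exact mem_of_eq_relu_sub
          (apply_mem_linearReadouts (F := fun i z => relu (f i z)) (Sum.inr 0))
          (apply_mem_linearReadouts (F := fun i z => relu (f i z)) (Sum.inr 1))
      · simp; omega
      · simp only [HiddenLayers.numParams, Fintype.card_sum, Fintype.card_fin]
        have h1 : (k' + 2) * Fintype.card κ ≤ (3 * k') * (5 * k) :=
          Nat.mul_le_mul (by omega) hcard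
        nlinarith [Nat.zero_le (d * (k' * k)), Nat.zero_le (d * k')]

/-! ### Memorizers and the perturbed net -/

section memorization

variable {m : ℕ} {x : Fin m → Fin d → ℝ} (r : Fin m → ℝ) {ρ : Measure (Fin d → ℝ)}
  [IsFiniteMeasure ρ]

/-- One bump per data point, centred on the hyperplane through `x j` parallel to `ker w`. -/
lemma exists_one_layer_memorizer (hd : 0 < d) (hρ : ∀ᵐ z ∂ρ, z ∈ cube d) (hac : ρ ≪ volume)
    (hx : Function.Injective x) (hxc : ∀ i, x i ∈ cube d) {ε : ℝ} (hε : 0 < ε) :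
    ∃ (ψ : Fin m × Fin 4 → (Fin d → ℝ) → ℝ) (h : (Fin d → ℝ) → ℝ),
      (∀ q, ψ q ∈ affineReadouts fun (i : Fin d) (z : Fin d → ℝ) => z i) ∧
      h ∈ linearReadouts (fun q z => relu (ψ q z)) ∧
      (∀ i, h (x i) = r i) ∧ eLpNorm h 2 ρ ≤ ENNReal.ofReal ε := by
  obtain ⟨w, hw, hinj⟩ := exists_dual_injective_comp hd hx
  have hwc : Continuous w := w.continuous_of_finiteDimensional
  obtain ⟨M, c, h1, h2⟩ := exists_bump_sum ρ hρ (fun j z => w z - w (x j)) (fun j _ => r j)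
    (fun j => hwc.sub continuous_const) (fun j => continuous_const)
    (fun j => by simpa only [sub_eq_zero] using measure_hyperplane_eq_zero hac hw (w (x j)))
    x hxc r (fun i => ⟨i, sub_self _, rfl, fun j hj h => hj (hinj (sub_eq_zero.1 h).symm)⟩) hε
  exact ⟨_, _, bumpNeurons_mem
    (fun j => sub_mem (linear_mem_affineReadouts w) (const_mem_affineReadouts _))
    (fun j => const_mem_affineReadouts _), sum_bump_mem M c _ _, h1, h2⟩

lemma exists_two_layer_memorizer (hd : 0 < d) (hρ : ∀ᵐ z ∂ρ, z ∈ cube d) (hac : ρ ≪ volume)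
    (hx : Function.Injective x) (hxc : ∀ i, x i ∈ cube d) {ε : ℝ} (hε : 0 < ε)
    {A B : ℕ} (hB : 0 < B) (hAB : m ≤ A * B) :
    ∃ (φ : Fin A → (Fin d → ℝ) → ℝ) (ψ : Fin B × Fin 4 → (Fin d → ℝ) → ℝ) (h : (Fin d → ℝ) → ℝ),
      (∀ l, φ l ∈ affineReadouts fun (i : Fin d) (z : Fin d → ℝ) => z i) ∧
      (∀ q, ψ q ∈ affineReadouts fun l z => relu (φ l z)) ∧
      h ∈ linearReadouts (fun q z => relu (ψ q z)) ∧
      (∀ i, h (x i) = r i) ∧ eLpNorm h 2 ρ ≤ ENNReal.ofReal ε := by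
  classical
  obtain ⟨w, hw, hinj⟩ := exists_dual_injective_comp hd hx
  have hwc : Continuous w := w.continuous_of_finiteDimensional
  obtain ⟨e, U, V, hU, hV, hfin, hS⟩ := exists_brokenLines
    (Finset.univ.image fun i => w (x i)) (Function.extend (fun i => w (x i)) r 0) A B hB
    (Finset.card_image_le.trans (by simpa using hAB))
  have hcont : ∀ f : ℝ → ℝ, (∃ (c : Fin A → ℝ) (β : ℝ), ∀ t,
      f t = ∑ l, c l * relu (t - e l) + β) → Continuous f := by
    rintro f ⟨c, β, hf⟩
    rw [funext hf]
    exact (continuous_finsetSum _ fun l _ => continuous_const.mul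
      (continuous_relu.comp (continuous_id.sub continuous_const))).add continuous_const
  have hmem : ∀ f : ℝ → ℝ, (∃ (c : Fin A → ℝ) (β : ℝ), ∀ t,
      f t = ∑ l, c l * relu (t - e l) + β) →
      (fun z => f (w z)) ∈ affineReadouts fun (l : Fin A) z => relu (w z - e l) := by
    rintro f ⟨c, β, hf⟩
    exact mem_affineReadouts_iff.2 ⟨c, β, fun z => hf _⟩
  obtain ⟨M, c, h1, h2⟩ := exists_bump_sum ρ hρ (fun j z => U j (w z)) (fun j z => V j (w z))
    (fun j => (hcont _ (hU j)).comp hwc) (fun j => (hcont _ (hV j)).comp hwc)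
    (fun j => by
      have : {z | U j (w z) = 0} = ⋃ t ∈ {t | U j t = 0}, {z | w z = t} := by ext; simp
      rw [this, measure_biUnion_null_iff (hfin j).countable]
      exact fun t _ => measure_hyperplane_eq_zero hac hw t)
    x hxc r (fun i => by
      obtain ⟨j, h1, h2, h3⟩ := hS (w (x i)) (Finset.mem_image_of_mem _ (Finset.mem_univ i))
      exact ⟨j, h1, h2.trans (hinj.extend_apply r 0 i), h3⟩) hε
  exact ⟨fun l z => w z - e l, _, _,
    fun l => sub_mem (linear_mem_affineReadouts w) (const_mem_affineReadouts _),
    bumpNeurons_mem (fun j => hmem _ (hU j)) (fun j => hmem _ (hV j)), sum_bump_mem M c _ _, h1, h2⟩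

lemma DFCN.exists_interpolating_perturbation (hd : 0 < d) (hρ : ∀ᵐ z ∂ρ, z ∈ cube d)
    (hac : ρ ≪ volume) (hx : Function.Injective x) (hxc : ∀ i, x i ∈ cube d) {ε : ℝ}
    (hε : 0 < ε) {L : ℕ} (hL : 1 ≤ L) (g : DFCN d L) :
    ∃ (f : DFCN d L) (h : (Fin d → ℝ) → ℝ), f.numParams ≤ (4 * d + 25) * (m + g.numParams) ∧
      (∀ z, f.eval z = g.eval z + h z) ∧ (∀ i, h (x i) = r i) ∧
      eLpNorm h 2 ρ ≤ ENNReal.ofReal ε := by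
  -- A net with one hidden layer has no room for the two-layer memorizer, but there the `4 * m`
  -- extra neurons meet only the `d` inputs, so the cost stays linear.
  rcases Nat.lt_or_ge L 2 with hL' | hL'
  · obtain rfl : L = 1 := by omega
    obtain ⟨ψ, h, hψ, hh, h1, h2⟩ := exists_one_layer_memorizer r hd hρ hac hx hxc hε
    obtain ⟨k, N, a⟩ := g
    cases N with
    | @layer _ k₀ N₀ k₁ hk₁ W₁ b₁ =>
    cases N₀
    have : Nonempty (Fin k) := ⟨⟨0, hk₁⟩⟩
    let f : Fin k ⊕ Fin m × Fin 4 → (Fin d → ℝ) → ℝ :=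
      Sum.elim (fun i z => (W₁.mulVec z + b₁) i) ψ
    have hf : ∀ i, f i ∈ affineReadouts fun (i : Fin d) (z : Fin d → ℝ) => z i := by
      rintro (i | l)
      · exact layer_mem_affineReadouts .input W₁ b₁ i
      · exact hψ l
    have hg := linearReadouts_mono
      (fun i => apply_mem_linearReadouts (F := fun i z => relu (f i z)) (Sum.inl i))
      (DFCN.eval_mem_linearReadouts ⟨k, .layer .input k hk₁ W₁ b₁, a⟩)
    have hh' := linearReadouts_mono
      (fun i => apply_mem_linearReadouts (F := fun i z => relu (f i z)) (Sum.inr i)) hh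
    obtain ⟨N, hN, -, hev⟩ := (realizable_input.layer hf).exists_net (add_mem hg hh')
    refine ⟨N, h, ?_, hev, h1, h2⟩
    rw [hN]
    simp only [DFCN.numParams, HiddenLayers.numParams, Fintype.card_sum, Fintype.card_prod,
      Fintype.card_fin]
    nlinarith [Nat.zero_le (d * (k * d)), Nat.zero_le (d * k), Nat.zero_le (d * m),
      Nat.mul_le_mul_right m hd]
  · obtain ⟨κ, _, F, P, h, hR, hN, hh, ⟨h1, h2⟩, hcard, hP⟩ := exists_augmented_layers
      (Good := fun h => (∀ i, h (x i) = r i) ∧ eLpNorm h 2 ρ ≤ ENNReal.ofReal ε) (m := m)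
      (fun A B hB hAB => exists_two_layer_memorizer r hd hρ hac hx hxc hε hB hAB) g.layers hL'
    obtain ⟨f, hf, -, hev⟩ := hR.exists_net
      (add_mem (linearReadouts_mono hN g.eval_mem_linearReadouts) hh)
    refine ⟨f, h, ?_, hev, h1, h2⟩
    rw [hf, DFCN.numParams]
    nlinarith

end memorization

theorem theorem6 (d : ℕ) (hd : 0 < d) :
    ∃ c₁ c₂ : ℝ, 0 < c₁ ∧ 0 < c₂ ∧
      ∀ (X : Set (Fin d → ℝ)) (_ : MeasurableSet X) (_ : X ⊆ cube d)
        (ρ : Measure (Fin d → ℝ)) (_ : IsProbabilityMeasure ρ) (_ : ρ Xᶜ = 0)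
        (p : ℝ≥0∞) (_ : 2 ≤ p) (_ : p ≠ ∞) (_ : distortion X ρ p < ∞)
        (m : ℕ) (x : Fin m → Fin d → ℝ) (y : Fin m → ℝ)
        (_ : Function.Injective x) (_ : ∀ i, x i ∈ cube d)
        (L n : ℕ) (_ : 1 ≤ L) (g : DFCN d L) (_ : g.numParams = n)
        (Cstar : ℝ) (_ : 0 < Cstar)
        (_ : eLpNorm g.eval ∞ (volume.restrict (cube d)) ≤ ENNReal.ofReal Cstar)
        (ε : ℝ) (_ : 0 < ε),
        ∃ f : DFCN d (L + ⌈c₁ * max (Real.log (1 / ε)) 0⌉₊),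
          (f.numParams : ℝ) ≤ c₂ * (m + n + max (Real.log (1 / ε)) 0) ∧
          (∀ i, f.eval (x i) = y i) ∧
          eLpNorm (fun z => f.eval z - g.eval z) 2 ρ ≤ ENNReal.ofReal ε := by
  -- The factor `2` pays for the width in the padding step. The `6` covers the padding layers, and
  -- the `+ 1` from the ceiling is absorbed by `1 ≤ n`.
  refine ⟨1, 2 * (4 * d + 25) + 6, one_pos, by positivity, ?_⟩
  intro X _ hXc ρ _ hXρ p _ _ hdist m x y hx hxc L n hL g hn _ _ _ ε hε
  have hρ : ∀ᵐ z ∂ρ, z ∈ cube d := by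
    filter_upwards [mem_ae_iff.2 hXρ] with z hz using hXc hz
  obtain ⟨f, h, hf, hev, h1, h2⟩ := g.exists_interpolating_perturbation
    (fun i => y i - g.eval (x i)) hd hρ (absolutelyContinuous_of_distortion_lt_top hdist) hx hxc
    hε hL
  set l : ℝ := max (Real.log (1 / ε)) 0 with hl
  have hl0 : 0 ≤ l := le_max_right _ _
  obtain ⟨f', hf', hev'⟩ := f.exists_add_layers ⌈1 * l⌉₊
  refine ⟨f', ?_, fun i => ?_, ?_⟩
  · have hn1 : 1 ≤ n := by
      obtain ⟨k, N, a⟩ := g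
      cases N with
      | input => omega
      | layer N k' hk' W b => simp only [DFCN.numParams, HiddenLayers.numParams] at hn; omega
    have hK : (⌈1 * l⌉₊ : ℝ) < l + 1 := by
      rw [one_mul]; exact Nat.ceil_lt_add_one hl0
    have hw : f.width ≤ f.numParams := Nat.le_add_left _ _
    have h3 : f'.numParams ≤ 2 * ((4 * d + 25) * (m + n)) + 6 * ⌈1 * l⌉₊ := by
      subst hn; omega
    have h4 : (f'.numParams : ℝ) ≤ 2 * ((4 * d + 25) * (m + n)) + 6 * (⌈1 * l⌉₊ : ℝ) := by
      exact_mod_cast h3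
    have hn1' : (1 : ℝ) ≤ n := by exact_mod_cast hn1
    have : 0 ≤ (d : ℝ) * l := by positivity
    have : (0 : ℝ) ≤ m := by positivity
    nlinarith
  · rw [hev', hev, h1]; ring
  · simpa only [hev', hev, add_sub_cancel_left] using h2
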